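/- **Language.** Fix a set $\mathsf{Atprop}$ of propositional variables $p$. There are two types, $\mathsf{DL}$ and $\mathsf{K}$. Formulas are given by $$\mathsf{DL}\ni A ::= p \mid \top \mid \bot \mid \Box\alpha \mid A\wedge A \mid A\vee A, \qquad \mathsf{K}\ni \alpha ::= 1 \mid 0 \mid \circ A \mid {\sim}\alpha \mid \alpha\cap\alpha \mid \alpha\cup\alpha ,$$ and structures by $$\mathsf{DL}\ni X ::= A \mid \hat\top \mid \check\bot \mid \check\Box\,\Gamma \mid \hat\bullet_\ell\,\Gamma \mid \check\bullet_r\,\Gamma \mid X\,\hat\wedge\, X \mid X\,\check\vee\, X \mid X\,\hat{>}\, X \mid X\,\check\to\, X ,$$ $$\mathsf{K}\ni \Gamma ::= \alpha \mid \hat 1 \mid \check 0 \mid \tilde\circ X \mid \hat\blacklozenge X \mid \tilde *\,\Gamma \mid \Gamma\,\hat\cap\,\Gamma \mid \Gamma\,\check\cup\,\Gamma \mid \Gamma\,\hat\supset\,\Gamma \mid \Gamma\,\check\supset\,\Gamma .$$ A sequent is $S\vdash T$ with $S,T$ structures of the same type. Below, $A,B$ are formulas and $X,Y,Z,W$ structures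 of type $\mathsf{DL}$; $\alpha,\beta$ are formulas and $\Gamma,\Delta,\Theta,\Xi$ structures of type $\mathsf{K}$. We write $S_1;\dots;S_n\,/\,S$ for the rule with premises $S_i$ and conclusion $S$, and $S\,//\,S'$ for the two rules $S/S'$ and $S'/S$. **The calculus D.SM** has the following rules. * Identity and cut: $/\ p\vdash p$; $\quad X\vdash A;\ A\vdash Y\ /\ X\vdash Y$; $\quad \Gamma\vdash\alpha;\ \alpha\vdash\Delta\ /\ \Gamma\vdash\Delta$. The last two are the cut rules. * Display rules: $X\hat\wedge Y\vdash Z\,//\,Y\vdash X\check\to Z$; $\ X\vdash Y\check\vee Z\,//\,Y\hat{>}X\vdash Z$; $\ \Gamma\hat\cap\Delta\vdash\Theta\,//\,\Delta\vdash\Gamma\check\supset\Theta$; $\ \Gamma\vdash\Delta\check\cup\Theta\,//\,\Delta\hat\supset\Gamma\vdash\Theta$; $\ \tilde*\Gamma\vdash\Delta\,//\,\tilde*\Delta\vdash\Gamma$; $\ \Gamma\vdash\tilde*\Delta\,//\,\Delta\vdash\tilde*\Gamma$; $\ X\vdash\check\Box\Gamma\,//\,\hat\blacklozenge X\vdash\Gamma$;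 $\ \tilde\circ X\vdash\Gamma\,//\,X\vdash\check\bullet_r\Gamma$; $\ \Gamma\vdash\tilde\circ X\,//\,\hat\bullet_\ell\Gamma\vdash X$. * Structural rules of type $\mathsf{DL}$: $X\vdash Y\,//\,X\hat\wedge\hat\top\vdash Y$; $\ X\vdash Y\,//\,X\vdash Y\check\vee\check\bot$; $\ X\hat\wedge Y\vdash Z\,/\,Y\hat\wedge X\vdash Z$; $\ X\vdash Y\check\vee Z\,/\,X\vdash Z\check\vee Y$; $\ (X\hat\wedge Y)\hat\wedge Z\vdash W\,//\,X\hat\wedge(Y\hat\wedge Z)\vdash W$; $\ X\vdash(Y\check\vee Z)\check\vee W\,//\,X\vdash Y\check\vee(Z\check\vee W)$; $\ X\vdash Y\,/\,X\hat\wedge Z\vdash Y$; $\ X\vdash Y\,/\,X\vdash Y\check\vee Z$; $\ X\hat\wedge X\vdash Y\,/\,X\vdash Y$; $\ X\vdash Y\check\vee Y\,/\,X\vdash Y$. * Structural rules of type $\mathsf{K}$: the same rules with $\hat\wedge,\check\vee,\hat\top,\check\bot$ replaced by $\hat\cap,\check\cup,\hat1,\check0$ and structures of type $\mathsf{K}$,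 and $\Gamma\vdash\Delta\,//\,\tilde*\Delta\vdash\tilde*\Gamma$. * Multi-type structural rules: $X\vdash Y\,/\,\tilde\circ X\vdash\tilde\circ Y$; $\ \hat\bullet_\ell\Gamma\vdash\check\bullet_r\Delta\,/\,\Gamma\vdash\Delta$; $\ \hat1\vdash\Gamma\,/\,\hat\blacklozenge\hat\top\vdash\Gamma$; $\ X\vdash\check\Box\check0\,/\,X\vdash\check\bot$; $\ \Gamma\vdash\tilde\circ\check\Box\Delta\,//\,\Gamma\vdash\Delta$. * Operational rules of type $\mathsf{DL}$: $\hat\top\vdash X\,/\,\top\vdash X$; $\ /\,\hat\top\vdash\top$; $\ /\,\bot\vdash\check\bot$; $\ X\vdash\check\bot\,/\,X\vdash\bot$; $\ A\hat\wedge B\vdash X\,/\,A\wedge B\vdash X$; $\ X\vdash A;\,Y\vdash B\,/\,X\hat\wedge Y\vdash A\wedge B$; $\ A\vdash X;\,B\vdash Y\,/\,A\vee B\vdash X\check\vee Y$; $\ X\vdash A\check\vee B\,/\,X\vdash A\vee B$. * Operational rules of type $\mathsf{K}$: the same rules with $\top,\bot,\wedge,\vee$ (and their structural counterparts) replaced by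 $1,0,\cap,\cup$ (and theirs), and $\tilde*\alpha\vdash\Gamma\,/\,{\sim}\alpha\vdash\Gamma$; $\ \Gamma\vdash\tilde*\alpha\,/\,\Gamma\vdash{\sim}\alpha$. * Multi-type operational rules: $\tilde\circ A\vdash\Gamma\,/\,\circ A\vdash\Gamma$; $\ \Gamma\vdash\tilde\circ A\,/\,\Gamma\vdash\circ A$; $\ \alpha\vdash\Gamma\,/\,\Box\alpha\vdash\check\Box\Gamma$; $\ X\vdash\check\Box\alpha\,/\,X\vdash\Box\alpha$. **The extensions.** * D.LQM is D.SM plus $X\vdash Y\,/\,X\vdash\check\Box\tilde\circ Y$. * D.UQM is D.SM plus $\hat\bullet_\ell\hat\blacklozenge X\vdash Y\,/\,X\vdash Y$. * D.DP is D.SM plus $\Gamma\hat\cap\Delta\vdash\Theta\,//\,\Delta\vdash\tilde*\Gamma\check\cup\Theta$. * D.AP is D.DP plus $X\vdash\check\Box\tilde*\tilde\circ Y\,/\,X\hat\wedge Y\vdash\check\bot$. * D.WS is D.DP plus $\hat\blacklozenge X\vdash\Delta\,/\,\hat\blacklozenge(\check\Box\tilde*\tilde\circ X\ \hat{>}\ \hat\top)\vdash\Delta$.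 **Theorem (cut elimination and subformula property).** Let $\mathsf{D}$ be any of the six calculi D.SM, D.LQM, D.UQM, D.DP, D.AP, D.WS. 1. (Cut elimination) Every sequent derivable in $\mathsf{D}$ has a derivation in $\mathsf{D}$ that contains no application of a cut rule. 2. (Subformula property) In every cut-free derivation in $\mathsf{D}$, each formula occurring in any of its sequents is a subformula of a formula occurring in its end sequent. Here the subformulas of a formula may be of either type (e.g. $\alpha$ is a subformula of $\Box\alpha$ and $A$ of $\circ A$), and every formula is a subformula of itself. -/

import Mathlib

namespace SDM

/-- The two types of the multi-type language. -/
inductive Ty where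
  | DL
  | K

/-- Formulas (operational terms) of the multi-type language over the propositional variables `P`:
`A ::= p | ⊤ | ⊥ | □ α | A ∧ A | A ∨ A` in type `DL`, and
`α ::= 1 | 0 | ∘ A | ∼ α | α ∩ α | α ∪ α` in type `K`. -/
inductive Fm (P : Type*) : Ty → Type _ where
  | var (p : P) : Fm P .DL
  | top : Fm P .DL
  | bot : Fm P .DL
  | box (α : Fm P .K) : Fm P .DL
  | and (A B : Fm P .DL) : Fm P .DL
  | or (A B : Fm P .DL) : Fm P .DL
  | one : Fm P .K
  | zero : Fm P .K
  | circ (A : Fm P .DL) : Fm P .K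
  | neg (α : Fm P .K) : Fm P .K
  | cap (α β : Fm P .K) : Fm P .K
  | cup (α β : Fm P .K) : Fm P .K

/-- Structures. Every formula is a structure of the same type; all other constructors are the
structural connectives. -/
inductive Str (P : Type*) : Ty → Type _ where
  /-- a formula, regarded as a structure -/
  | fm {t : Ty} (A : Fm P t) : Str P t
  /-- `⊤` with a hat -/
  | top : Str P .DL
  /-- `⊥` with a check -/
  | bot : Str P .DL
  /-- `□` with a check -/
  | box (Γ : Str P .K) : Str P .DL
  /-- `•_ℓ` with a hat (left adjoint of `circ`) -/
  | bulL (Γ : Str P .K) : Str P .DL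
  /-- `•_r` with a check (right adjoint of `circ`) -/
  | bulR (Γ : Str P .K) : Str P .DL
  /-- `∧` with a hat -/
  | and (X Y : Str P .DL) : Str P .DL
  /-- `∨` with a check -/
  | or (X Y : Str P .DL) : Str P .DL
  /-- the co-implication `>-` with a hat (left residual of `or`) -/
  | coimp (X Y : Str P .DL) : Str P .DL
  /-- the implication `→` with a check (right residual of `and`) -/
  | imp (X Y : Str P .DL) : Str P .DL
  /-- `1` with a hat -/
  | one : Str P .K
  /-- `0` with a check -/
  | zero : Str P .K
  /-- `∘` with a tilde -/
  | circ (X : Str P .DL) : Str P .K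
  /-- `◆` with a hat (left adjoint of `box`) -/
  | dia (X : Str P .DL) : Str P .K
  /-- `*` with a tilde (the structural counterpart of `∼`) -/
  | star (Γ : Str P .K) : Str P .K
  /-- `∩` with a hat -/
  | cap (Γ Δ : Str P .K) : Str P .K
  /-- `∪` with a check -/
  | cup (Γ Δ : Str P .K) : Str P .K
  /-- the co-implication `⊃-` with a hat (left residual of `cup`) -/
  | kcoimp (Γ Δ : Str P .K) : Str P .K
  /-- the implication `-⊃` with a check (right residual of `cap`) -/
  | kimp (Γ Δ : Str P .K) : Str P .K

/-- A sequent: two structures of the same type. -/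
structure Sequent (P : Type*) where
  {ty : Ty}
  ant : Str P ty
  suc : Str P ty

infix:50 " ⊢ₛ " => Sequent.mk

/-- The names of the six calculi D.SM, D.LQM, D.UQM, D.DP, D.AP, D.WS. -/
inductive Calculus where
  | SM
  | LQM
  | UQM
  | DP
  | AP
  | WS

section Rules

variable {P : Type*}

/-- The double-line rules: `DoubleRule L s t` means that `t` may be inferred from `s` and
`s` may be inferred from `t` in the calculus `L`. -/
inductive DoubleRule (L : Calculus) : Sequent P → Sequent P → Prop where
  -- display rules, pure type DL
  | res_and (X Y Z : Str P .DL) : DoubleRule L (.and X Y ⊢ₛ Z) (Y ⊢ₛ .imp X Z)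
  | res_or (X Y Z : Str P .DL) : DoubleRule L (X ⊢ₛ .or Y Z) (.coimp Y X ⊢ₛ Z)
  -- display rules, pure type K
  | res_cap (Γ Δ Θ : Str P .K) : DoubleRule L (.cap Γ Δ ⊢ₛ Θ) (Δ ⊢ₛ .kimp Γ Θ)
  | res_cup (Γ Δ Θ : Str P .K) : DoubleRule L (Γ ⊢ₛ .cup Δ Θ) (.kcoimp Δ Γ ⊢ₛ Θ)
  | adj_star_l (Γ Δ : Str P .K) : DoubleRule L (.star Γ ⊢ₛ Δ) (.star Δ ⊢ₛ Γ)
  | adj_star_r (Γ Δ : Str P .K) : DoubleRule L (Γ ⊢ₛ .star Δ) (Δ ⊢ₛ .star Γ)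
  -- display rules, multi-type
  | adj_box (X : Str P .DL) (Γ : Str P .K) : DoubleRule L (X ⊢ₛ .box Γ) (.dia X ⊢ₛ Γ)
  | adj_circ_l (X : Str P .DL) (Γ : Str P .K) : DoubleRule L (.circ X ⊢ₛ Γ) (X ⊢ₛ .bulR Γ)
  | adj_circ_r (X : Str P .DL) (Γ : Str P .K) : DoubleRule L (Γ ⊢ₛ .circ X) (.bulL Γ ⊢ₛ X)
  -- structural rules, pure type DL
  | top (X Y : Str P .DL) : DoubleRule L (X ⊢ₛ Y) (.and X .top ⊢ₛ Y)
  | bot (X Y : Str P .DL) : DoubleRule L (X ⊢ₛ Y) (X ⊢ₛ .or Y .bot)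
  | assoc_and (X Y Z W : Str P .DL) :
      DoubleRule L (.and (.and X Y) Z ⊢ₛ W) (.and X (.and Y Z) ⊢ₛ W)
  | assoc_or (X Y Z W : Str P .DL) :
      DoubleRule L (X ⊢ₛ .or (.or Y Z) W) (X ⊢ₛ .or Y (.or Z W))
  -- structural rules, pure type K
  | one (Γ Δ : Str P .K) : DoubleRule L (Γ ⊢ₛ Δ) (.cap Γ .one ⊢ₛ Δ)
  | zero (Γ Δ : Str P .K) : DoubleRule L (Γ ⊢ₛ Δ) (Γ ⊢ₛ .cup Δ .zero)
  | assoc_cap (Γ Δ Θ Ξ : Str P .K) :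
      DoubleRule L (.cap (.cap Γ Δ) Θ ⊢ₛ Ξ) (.cap Γ (.cap Δ Θ) ⊢ₛ Ξ)
  | assoc_cup (Γ Δ Θ Ξ : Str P .K) :
      DoubleRule L (Γ ⊢ₛ .cup (.cup Δ Θ) Ξ) (Γ ⊢ₛ .cup Δ (.cup Θ Ξ))
  | cont (Γ Δ : Str P .K) : DoubleRule L (Γ ⊢ₛ Δ) (.star Δ ⊢ₛ .star Γ)
  -- structural rule, multi-type
  | circ_box (Γ Δ : Str P .K) : DoubleRule L (Γ ⊢ₛ .circ (.box Δ)) (Γ ⊢ₛ Δ)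
  -- the characteristic rule of D.DP, also present in D.AP and D.WS
  | res_B (h : L = .DP ∨ L = .AP ∨ L = .WS) (Γ Δ Θ : Str P .K) :
      DoubleRule L (.cap Γ Δ ⊢ₛ Θ) (Δ ⊢ₛ .cup (.star Γ) Θ)

/-- All rules of the calculus `L` except the two cut rules: `Rule L ps s` means that `s` may be
inferred from the list of premises `ps` by one application of a rule. -/
inductive Rule (L : Calculus) : List (Sequent P) → Sequent P → Prop where
  | id (p : P) : Rule L [] (.fm (.var p) ⊢ₛ .fm (.var p))
  -- the double-line rules, in both directions
  | down {s t : Sequent P} (h : DoubleRule L s t) : Rule L [s] t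
  | up {s t : Sequent P} (h : DoubleRule L s t) : Rule L [t] s
  -- structural rules, pure type DL
  | exch_and (X Y Z : Str P .DL) : Rule L [.and X Y ⊢ₛ Z] (.and Y X ⊢ₛ Z)
  | exch_or (X Y Z : Str P .DL) : Rule L [X ⊢ₛ .or Y Z] (X ⊢ₛ .or Z Y)
  | weak_and (X Y Z : Str P .DL) : Rule L [X ⊢ₛ Y] (.and X Z ⊢ₛ Y)
  | weak_or (X Y Z : Str P .DL) : Rule L [X ⊢ₛ Y] (X ⊢ₛ .or Y Z)
  | contr_and (X Y : Str P .DL) : Rule L [.and X X ⊢ₛ Y] (X ⊢ₛ Y)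
  | contr_or (X Y : Str P .DL) : Rule L [X ⊢ₛ .or Y Y] (X ⊢ₛ Y)
  -- structural rules, pure type K
  | exch_cap (Γ Δ Θ : Str P .K) : Rule L [.cap Γ Δ ⊢ₛ Θ] (.cap Δ Γ ⊢ₛ Θ)
  | exch_cup (Γ Δ Θ : Str P .K) : Rule L [Γ ⊢ₛ .cup Δ Θ] (Γ ⊢ₛ .cup Θ Δ)
  | weak_cap (Γ Δ Θ : Str P .K) : Rule L [Γ ⊢ₛ Δ] (.cap Γ Θ ⊢ₛ Δ)
  | weak_cup (Γ Δ Θ : Str P .K) : Rule L [Γ ⊢ₛ Δ] (Γ ⊢ₛ .cup Δ Θ)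
  | contr_cap (Γ Δ : Str P .K) : Rule L [.cap Γ Γ ⊢ₛ Δ] (Γ ⊢ₛ Δ)
  | contr_cup (Γ Δ : Str P .K) : Rule L [Γ ⊢ₛ .cup Δ Δ] (Γ ⊢ₛ Δ)
  -- structural rules, multi-type
  | circ (X Y : Str P .DL) : Rule L [X ⊢ₛ Y] (.circ X ⊢ₛ .circ Y)
  | bul (Γ Δ : Str P .K) : Rule L [.bulL Γ ⊢ₛ .bulR Δ] (Γ ⊢ₛ Δ)
  | dia_one (Γ : Str P .K) : Rule L [.one ⊢ₛ Γ] (.dia .top ⊢ₛ Γ)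
  | box_zero (X : Str P .DL) : Rule L [X ⊢ₛ .box .zero] (X ⊢ₛ .bot)
  -- operational rules, pure type DL
  | top_l (X : Str P .DL) : Rule L [.top ⊢ₛ X] (.fm .top ⊢ₛ X)
  | top_r : Rule L [] (.top ⊢ₛ .fm .top)
  | bot_l : Rule L [] (.fm .bot ⊢ₛ .bot)
  | bot_r (X : Str P .DL) : Rule L [X ⊢ₛ .bot] (X ⊢ₛ .fm .bot)
  | and_l (A B : Fm P .DL) (X : Str P .DL) :
      Rule L [.and (.fm A) (.fm B) ⊢ₛ X] (.fm (.and A B) ⊢ₛ X)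
  | and_r (A B : Fm P .DL) (X Y : Str P .DL) :
      Rule L [X ⊢ₛ .fm A, Y ⊢ₛ .fm B] (.and X Y ⊢ₛ .fm (.and A B))
  | or_l (A B : Fm P .DL) (X Y : Str P .DL) :
      Rule L [.fm A ⊢ₛ X, .fm B ⊢ₛ Y] (.fm (.or A B) ⊢ₛ .or X Y)
  | or_r (A B : Fm P .DL) (X : Str P .DL) :
      Rule L [X ⊢ₛ .or (.fm A) (.fm B)] (X ⊢ₛ .fm (.or A B))
  -- operational rules, pure type K
  | one_l (Γ : Str P .K) : Rule L [.one ⊢ₛ Γ] (.fm .one ⊢ₛ Γ)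
  | one_r : Rule L [] (.one ⊢ₛ .fm .one)
  | zero_l : Rule L [] (.fm .zero ⊢ₛ .zero)
  | zero_r (Γ : Str P .K) : Rule L [Γ ⊢ₛ .zero] (Γ ⊢ₛ .fm .zero)
  | cap_l (α β : Fm P .K) (Γ : Str P .K) :
      Rule L [.cap (.fm α) (.fm β) ⊢ₛ Γ] (.fm (.cap α β) ⊢ₛ Γ)
  | cap_r (α β : Fm P .K) (Γ Δ : Str P .K) :
      Rule L [Γ ⊢ₛ .fm α, Δ ⊢ₛ .fm β] (.cap Γ Δ ⊢ₛ .fm (.cap α β))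
  | cup_l (α β : Fm P .K) (Γ Δ : Str P .K) :
      Rule L [.fm α ⊢ₛ Γ, .fm β ⊢ₛ Δ] (.fm (.cup α β) ⊢ₛ .cup Γ Δ)
  | cup_r (α β : Fm P .K) (Γ : Str P .K) :
      Rule L [Γ ⊢ₛ .cup (.fm α) (.fm β)] (Γ ⊢ₛ .fm (.cup α β))
  | neg_l (α : Fm P .K) (Γ : Str P .K) : Rule L [.star (.fm α) ⊢ₛ Γ] (.fm (.neg α) ⊢ₛ Γ)
  | neg_r (α : Fm P .K) (Γ : Str P .K) : Rule L [Γ ⊢ₛ .star (.fm α)] (Γ ⊢ₛ .fm (.neg α))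
  -- operational rules, multi-type
  | circ_l (A : Fm P .DL) (Γ : Str P .K) : Rule L [.circ (.fm A) ⊢ₛ Γ] (.fm (.circ A) ⊢ₛ Γ)
  | circ_r (A : Fm P .DL) (Γ : Str P .K) : Rule L [Γ ⊢ₛ .circ (.fm A)] (Γ ⊢ₛ .fm (.circ A))
  | box_l (α : Fm P .K) (Γ : Str P .K) : Rule L [.fm α ⊢ₛ Γ] (.fm (.box α) ⊢ₛ .box Γ)
  | box_r (α : Fm P .K) (X : Str P .DL) : Rule L [X ⊢ₛ .box (.fm α)] (X ⊢ₛ .fm (.box α))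
  -- characteristic rules of D.LQM, D.UQM, D.AP and D.WS
  | lqm (h : L = .LQM) (X Y : Str P .DL) : Rule L [X ⊢ₛ Y] (X ⊢ₛ .box (.circ Y))
  | uqm (h : L = .UQM) (X Y : Str P .DL) : Rule L [.bulL (.dia X) ⊢ₛ Y] (X ⊢ₛ Y)
  | ap (h : L = .AP) (X Y : Str P .DL) :
      Rule L [X ⊢ₛ .box (.star (.circ Y))] (.and X Y ⊢ₛ .bot)
  | ws (h : L = .WS) (X : Str P .DL) (Δ : Str P .K) :
      Rule L [.dia X ⊢ₛ Δ] (.dia (.coimp (.box (.star (.circ X))) .top) ⊢ₛ Δ)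

/-- Derivations (finite proof trees) in the calculus `L` with end sequent `s`. The constructor
`cut` comprises the two cut rules, one for each type. -/
inductive Deriv (L : Calculus) : Sequent P → Type _ where
  | rule {ps : List (Sequent P)} {s : Sequent P} (r : Rule L ps s)
      (ds : ∀ i : Fin ps.length, Deriv L (ps.get i)) : Deriv L s
  | cut {s : Sequent P} (A : Fm P s.ty)
      (d : Deriv L (s.ant ⊢ₛ .fm A)) (e : Deriv L (.fm A ⊢ₛ s.suc)) : Deriv L s

/-- The derivation contains no application of a cut rule. -/
def Deriv.CutFree {L : Calculus} {s : Sequent P} : Deriv L s → Prop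
  | .rule _ ds => ∀ i, (ds i).CutFree
  | .cut _ _ _ => False

/-- The set of all sequents occurring in a derivation, its end sequent included. -/
def Deriv.sequents {L : Calculus} {s : Sequent P} : Deriv L s → Set (Sequent P)
  | .rule _ ds => {s} ∪ ⋃ i, (ds i).sequents
  | .cut _ d e => {s} ∪ (d.sequents ∪ e.sequents)

/-- The subformulas (of either type) of a formula, the formula itself included. -/
def Fm.subformulas {t : Ty} : Fm P t → Set (Σ t, Fm P t)
  | .var p => {⟨_, .var p⟩}
  | .top => {⟨_, .top⟩}
  | .bot => {⟨_, .bot⟩}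
  | .box α => {⟨_, .box α⟩} ∪ α.subformulas
  | .and A B => {⟨_, .and A B⟩} ∪ (A.subformulas ∪ B.subformulas)
  | .or A B => {⟨_, .or A B⟩} ∪ (A.subformulas ∪ B.subformulas)
  | .one => {⟨_, .one⟩}
  | .zero => {⟨_, .zero⟩}
  | .circ A => {⟨_, .circ A⟩} ∪ A.subformulas
  | .neg α => {⟨_, .neg α⟩} ∪ α.subformulas
  | .cap α β => {⟨_, .cap α β⟩} ∪ (α.subformulas ∪ β.subformulas)
  | .cup α β => {⟨_, .cup α β⟩} ∪ (α.subformulas ∪ β.subformulas)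

/-- The formulas from which a structure is built by structural connectives. -/
def Str.formulas {t : Ty} : Str P t → Set (Σ t, Fm P t)
  | .fm A => {⟨_, A⟩}
  | .top => ∅
  | .bot => ∅
  | .box Γ => Γ.formulas
  | .bulL Γ => Γ.formulas
  | .bulR Γ => Γ.formulas
  | .and X Y => X.formulas ∪ Y.formulas
  | .or X Y => X.formulas ∪ Y.formulas
  | .coimp X Y => X.formulas ∪ Y.formulas
  | .imp X Y => X.formulas ∪ Y.formulas
  | .one => ∅
  | .zero => ∅
  | .circ X => X.formulas
  | .dia X => X.formulas
  | .star Γ => Γ.formulas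
  | .cap Γ Δ => Γ.formulas ∪ Δ.formulas
  | .cup Γ Δ => Γ.formulas ∪ Δ.formulas
  | .kcoimp Γ Δ => Γ.formulas ∪ Δ.formulas
  | .kimp Γ Δ => Γ.formulas ∪ Δ.formulas

/-- The formulas occurring in a sequent. -/
def Sequent.formulas (s : Sequent P) : Set (Σ t, Fm P t) := s.ant.formulas ∪ s.suc.formulas

end Rules

/-- Cut elimination for the calculus `L` over the propositional variables `P`: every sequent that
has a derivation has one without cuts. -/
def CutElimination (P : Type*) (L : Calculus) : Prop :=
  ∀ (s : Sequent P), Nonempty (Deriv L s) → ∃ d : Deriv L s, d.CutFree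

/-- The subformula property for the calculus `L` over the propositional variables `P`: every
formula occurring in a cut-free derivation is a subformula of a formula occurring in its end
sequent. -/
def SubformulaProperty (P : Type*) (L : Calculus) : Prop :=
  ∀ (s : Sequent P) (d : Deriv L s), d.CutFree →
    ∀ q ∈ d.sequents, ∀ A ∈ q.formulas, ∃ B ∈ s.formulas, A ∈ B.2.subformulas

end SDM

/-!
Cut elimination is Belnap's argument for display calculi. No structural rule mentions a formula,
each structure variable of a rule has the same polarity in premises and conclusion, and every
operational rule introduces its formula as the whole antecedent or the whole succedent. Hence
replacing in a cut-free derivation of `s` any set of occurrences of a formula `A` of one polarity by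
a structure `Z`, and tracing these occurrences upwards, every rule application remains one, except
where a traced `A` is introduced by an operational rule or by an identity axiom
(`Provable.replace`).

Applied once with `Z` the left-hand side of a sequent `Z ⊢ A` whose last rule introduces `A`, and
once with `Z` the right-hand side of `A ⊢ Z`, this reduces a cut on `A` to cuts in which both
premises introduce `A` (`Provable.cut_of_reduction`). Those are replaced by cuts on the immediate
subformulas, with the help of the display rules (`Provable.cut`).

The polarity is tracked also below structural connectives in positions where they cannot be
displayed, such as `□ Γ` in an antecedent, which weakening can create. The replacement passes
through them without displaying anything. Display rules are needed only once both premises of a cut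
introduce the cut formula, to isolate its immediate subformulas.

The subformula property is checked rule by rule (`Rule.exists_mem_subformulas`).
-/

namespace SDM

variable {P : Type*} {L : Calculus}

/-! ### Cut-free provability -/

/-- Derivability without the cut rules, as a proposition. -/
inductive Provable (L : Calculus) : Sequent P → Prop where
  | rule {ps : List (Sequent P)} {s : Sequent P} (r : Rule L ps s)
      (h : ∀ q ∈ ps, Provable L q) : Provable L s

theorem Provable.exists_cutFree {s : Sequent P} (h : Provable L s) :
    ∃ d : Deriv L s, d.CutFree := by
  induction h with
  | @rule ps s r _ ih =>
    choose d hd using fun i : Fin ps.length => ih (ps.get i) (List.get_mem ps i)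
    exact ⟨.rule r d, by simpa only [Deriv.CutFree] using hd⟩

theorem Provable.axm {s : Sequent P} (r : Rule L [] s) : Provable L s :=
  .rule r (by simp)

theorem Provable.one {q s : Sequent P} (r : Rule L [q] s) (h : Provable L q) : Provable L s :=
  .rule r (by simpa using h)

theorem Provable.two {q q' s : Sequent P} (r : Rule L [q, q'] s) (h : Provable L q)
    (h' : Provable L q') : Provable L s :=
  .rule r (by simpa using ⟨h, h'⟩)

theorem Provable.down {s t : Sequent P} (h : Provable L s) (r : DoubleRule L s t) :
    Provable L t := .one (.down r) h

theorem Provable.up {s t : Sequent P} (h : Provable L t) (r : DoubleRule L s t) :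
    Provable L s := .one (.up r) h

/-! ### Introduction of a formula by an operational rule -/

/-- `A ⊢ Y` is the conclusion of a left introduction rule for `A`, or of an identity axiom, with
cut-free provable premises. -/
def IntroL (L : Calculus) : {t : Ty} → Fm P t → Str P t → Prop
  | _, .var p, Y => Y = .fm (.var p)
  | _, .top, Y => Provable L (.top ⊢ₛ Y)
  | _, .bot, Y => Y = .bot
  | _, .box α, Y => ∃ Γ, Y = .box Γ ∧ Provable L (.fm α ⊢ₛ Γ)
  | _, .and A B, Y => Provable L (.and (.fm A) (.fm B) ⊢ₛ Y)
  | _, .or A B, Y => ∃ U V, Y = .or U V ∧ Provable L (.fm A ⊢ₛ U) ∧ Provable L (.fm B ⊢ₛ V)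
  | _, .one, Y => Provable L (.one ⊢ₛ Y)
  | _, .zero, Y => Y = .zero
  | _, .circ A, Y => Provable L (.circ (.fm A) ⊢ₛ Y)
  | _, .neg α, Y => Provable L (.star (.fm α) ⊢ₛ Y)
  | _, .cap α β, Y => Provable L (.cap (.fm α) (.fm β) ⊢ₛ Y)
  | _, .cup α β, Y => ∃ U V, Y = .cup U V ∧ Provable L (.fm α ⊢ₛ U) ∧ Provable L (.fm β ⊢ₛ V)

/-- `X ⊢ A` is the conclusion of a right introduction rule for `A`, or of an identity axiom, with
cut-free provable premises. -/
def IntroR (L : Calculus) : {t : Ty} → Fm P t → Str P t → Prop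
  | _, .var p, X => X = .fm (.var p)
  | _, .top, X => X = .top
  | _, .bot, X => Provable L (X ⊢ₛ .bot)
  | _, .box α, X => Provable L (X ⊢ₛ .box (.fm α))
  | _, .and A B, X => ∃ U V, X = .and U V ∧ Provable L (U ⊢ₛ .fm A) ∧ Provable L (V ⊢ₛ .fm B)
  | _, .or A B, X => Provable L (X ⊢ₛ .or (.fm A) (.fm B))
  | _, .one, X => X = .one
  | _, .zero, X => Provable L (X ⊢ₛ .zero)
  | _, .circ A, X => Provable L (X ⊢ₛ .circ (.fm A))
  | _, .neg α, X => Provable L (X ⊢ₛ .star (.fm α))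
  | _, .cap α β, X => ∃ U V, X = .cap U V ∧ Provable L (U ⊢ₛ .fm α) ∧ Provable L (V ⊢ₛ .fm β)
  | _, .cup α β, X => Provable L (X ⊢ₛ .cup (.fm α) (.fm β))

/-! ### Replacing occurrences of a formula -/

/-- `Hit A Z B T` says that `B` is `A` and `T` is `Z`. It is an inductive predicate because `A` and
`B` may have different types. -/
inductive Hit {a : Ty} (A : Fm P a) (Z : Str P a) : {t : Ty} → Fm P t → Str P t → Prop where
  | mk : Hit A Z A Z

/-- `Repl A Z b S T` says that `T` arises from `S` by replacing some (possibly no) occurrences of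
the formula `A` as a substructure by `Z`. Only the positive occurrences may be replaced if
`b = true`, and only the negative ones if `b = false`. -/
def Repl {a : Ty} (A : Fm P a) (Z : Str P a) : {t : Ty} → Bool → Str P t → Str P t → Prop
  | _, b, .fm B, T => T = .fm B ∨ (b = true ∧ Hit A Z B T)
  | _, _, .top, T => T = .top
  | _, _, .bot, T => T = .bot
  | _, b, .box Γ, T => ∃ Γ', T = .box Γ' ∧ Repl A Z b Γ Γ'
  | _, b, .bulL Γ, T => ∃ Γ', T = .bulL Γ' ∧ Repl A Z b Γ Γ'
  | _, b, .bulR Γ, T => ∃ Γ', T = .bulR Γ' ∧ Repl A Z b Γ Γ'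
  | _, b, .and X Y, T => ∃ X' Y', T = .and X' Y' ∧ Repl A Z b X X' ∧ Repl A Z b Y Y'
  | _, b, .or X Y, T => ∃ X' Y', T = .or X' Y' ∧ Repl A Z b X X' ∧ Repl A Z b Y Y'
  | _, b, .coimp X Y, T => ∃ X' Y', T = .coimp X' Y' ∧ Repl A Z (!b) X X' ∧ Repl A Z b Y Y'
  | _, b, .imp X Y, T => ∃ X' Y', T = .imp X' Y' ∧ Repl A Z (!b) X X' ∧ Repl A Z b Y Y'
  | _, _, .one, T => T = .one
  | _, _, .zero, T => T = .zero
  | _, b, .circ X, T => ∃ X', T = .circ X' ∧ Repl A Z b X X'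
  | _, b, .dia X, T => ∃ X', T = .dia X' ∧ Repl A Z b X X'
  | _, b, .star Γ, T => ∃ Γ', T = .star Γ' ∧ Repl A Z (!b) Γ Γ'
  | _, b, .cap X Y, T => ∃ X' Y', T = .cap X' Y' ∧ Repl A Z b X X' ∧ Repl A Z b Y Y'
  | _, b, .cup X Y, T => ∃ X' Y', T = .cup X' Y' ∧ Repl A Z b X X' ∧ Repl A Z b Y Y'
  | _, b, .kcoimp X Y, T => ∃ X' Y', T = .kcoimp X' Y' ∧ Repl A Z (!b) X X' ∧ Repl A Z b Y Y'
  | _, b, .kimp X Y, T => ∃ X' Y', T = .kimp X' Y' ∧ Repl A Z (!b) X X' ∧ Repl A Z b Y Y'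

theorem Repl.refl {a : Ty} (A : Fm P a) (Z : Str P a) {t : Ty} (b : Bool) (S : Str P t) :
    Repl A Z b S S := by
  induction S generalizing b <;> simp [Repl, *]

/-- Replacement in a sequent: `b = true` allows the replacement of occurrences in antecedent
position, `b = false` of those in succedent position. -/
inductive ReplSeq {a : Ty} (A : Fm P a) (Z : Str P a) (b : Bool) :
    Sequent P → Sequent P → Prop where
  | mk {t : Ty} {X X' Y Y' : Str P t} (hX : Repl A Z b X X') (hY : Repl A Z (!b) Y Y') :
      ReplSeq A Z b (X ⊢ₛ Y) (X' ⊢ₛ Y')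

set_option linter.unusedSimpArgs false in
/-- The double-line rules contain no formulas and respect polarity, so they are closed under
replacement, in both directions. -/
theorem DoubleRule.replace {a : Ty} {A : Fm P a} {Z : Str P a} {b : Bool} {s t : Sequent P}
    (r : DoubleRule L s t) :
    (∀ t', ReplSeq A Z b t t' → ∃ s', DoubleRule L s' t' ∧ ReplSeq A Z b s s') ∧
    (∀ s', ReplSeq A Z b s s' → ∃ t', DoubleRule L s' t' ∧ ReplSeq A Z b t t') := by
  constructor <;> rintro _ ⟨hX, hY⟩ <;> cases r <;>
    simp -failIfUnchanged only [Repl, Bool.not_not] at hX hY <;>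
    (try casesm* _ ∧ _, ∃ _, _) <;> subst_vars
  case left.res_and | right.res_and =>
    exact ⟨_, .res_and .., .mk (by simp [Repl, *]) (by simp [Repl, *])⟩
  case left.res_or | right.res_or =>
    exact ⟨_, .res_or .., .mk (by simp [Repl, *]) (by simp [Repl, *])⟩
  case left.res_cap | right.res_cap =>
    exact ⟨_, .res_cap .., .mk (by simp [Repl, *]) (by simp [Repl, *])⟩
  case left.res_cup | right.res_cup =>
    exact ⟨_, .res_cup .., .mk (by simp [Repl, *]) (by simp [Repl, *])⟩
  case left.adj_star_l | right.adj_star_l =>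
    exact ⟨_, .adj_star_l .., .mk (by simp [Repl, *]) (by simp [Repl, *])⟩
  case left.adj_star_r | right.adj_star_r =>
    exact ⟨_, .adj_star_r .., .mk (by simp [Repl, *]) (by simp [Repl, *])⟩
  case left.adj_box | right.adj_box =>
    exact ⟨_, .adj_box .., .mk (by simp [Repl, *]) (by simp [Repl, *])⟩
  case left.adj_circ_l | right.adj_circ_l =>
    exact ⟨_, .adj_circ_l .., .mk (by simp [Repl, *]) (by simp [Repl, *])⟩
  case left.adj_circ_r | right.adj_circ_r =>
    exact ⟨_, .adj_circ_r .., .mk (by simp [Repl, *]) (by simp [Repl, *])⟩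
  case left.top | right.top =>
    exact ⟨_, .top .., .mk (by simp [Repl, *]) (by simp [Repl, *])⟩
  case left.bot | right.bot =>
    exact ⟨_, .bot .., .mk (by simp [Repl, *]) (by simp [Repl, *])⟩
  case left.assoc_and | right.assoc_and =>
    exact ⟨_, .assoc_and .., .mk (by simp [Repl, *]) (by simp [Repl, *])⟩
  case left.assoc_or | right.assoc_or =>
    exact ⟨_, .assoc_or .., .mk (by simp [Repl, *]) (by simp [Repl, *])⟩
  case left.one | right.one =>
    exact ⟨_, .one .., .mk (by simp [Repl, *]) (by simp [Repl, *])⟩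
  case left.zero | right.zero =>
    exact ⟨_, .zero .., .mk (by simp [Repl, *]) (by simp [Repl, *])⟩
  case left.assoc_cap | right.assoc_cap =>
    exact ⟨_, .assoc_cap .., .mk (by simp [Repl, *]) (by simp [Repl, *])⟩
  case left.assoc_cup | right.assoc_cup =>
    exact ⟨_, .assoc_cup .., .mk (by simp [Repl, *]) (by simp [Repl, *])⟩
  case left.cont | right.cont =>
    exact ⟨_, .cont .., .mk (by simp [Repl, *]) (by simp [Repl, *])⟩
  case left.circ_box | right.circ_box =>
    exact ⟨_, .circ_box .., .mk (by simp [Repl, *]) (by simp [Repl, *])⟩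
  case left.res_B | right.res_B =>
    exact ⟨_, .res_B ‹_› .., .mk (by simp [Repl, *]) (by simp [Repl, *])⟩

set_option linter.unusedSimpArgs false in
/-- Replacing occurrences of `A` by `Z` preserves cut-free provability, provided that it does so
for sequents in which the replaced `A` has just been introduced on the corresponding side. -/
theorem Provable.replace {a : Ty} {A : Fm P a} {Z : Str P a} {b : Bool}
    (hL : b = true → ∀ Y, IntroL L A Y → Provable L (Z ⊢ₛ Y))
    (hR : b = false → ∀ X, IntroR L A X → Provable L (X ⊢ₛ Z))
    {s s' : Sequent P} (h : Provable L s) (hs : ReplSeq A Z b s s') : Provable L s' := by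
  induction h generalizing s' with
  | rule r h ih =>
  have fm_self {t : Ty} (b : Bool) (B : Fm P t) : Repl A Z b (.fm B) (.fm B) := .refl ..
  rcases hs with ⟨hX, hY⟩
  cases r
  case down r =>
    obtain ⟨q, r', hq⟩ := r.replace.1 _ (.mk hX hY)
    exact (ih _ (.head _) hq).down r'
  case up r =>
    obtain ⟨q, r', hq⟩ := r.replace.2 _ (.mk hX hY)
    exact (ih _ (.head _) hq).up r'
  case id =>
    rcases hX with rfl | ⟨rfl, ⟨⟩⟩ <;> rcases hY with rfl | ⟨hb, ⟨⟩⟩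
    · exact .axm (.id _)
    · exact hR (by simpa using hb) _ rfl
    · exact hL rfl _ rfl
    · simp at hb
  case top_l =>
    have h₁ := ih _ (.head _) (.mk (.refl ..) hY)
    rcases hX with rfl | ⟨rfl, ⟨⟩⟩
    · exact .one (.top_l ..) h₁
    · exact hL rfl _ h₁
  case bot_l =>
    obtain rfl := hY
    rcases hX with rfl | ⟨rfl, ⟨⟩⟩
    · exact .axm .bot_l
    · exact hL rfl _ rfl
  case and_l =>
    have h₁ := ih _ (.head _) (.mk (.refl ..) hY)
    rcases hX with rfl | ⟨rfl, ⟨⟩⟩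
    · exact .one (.and_l ..) h₁
    · exact hL rfl _ h₁
  case or_l =>
    rcases hY with ⟨U, V, rfl, hU, hV⟩
    have h₁ := ih _ (.head _) (.mk (fm_self ..) hU)
    have h₂ := ih _ (.tail _ (.head _)) (.mk (fm_self ..) hV)
    rcases hX with rfl | ⟨rfl, ⟨⟩⟩
    · exact .two (.or_l ..) h₁ h₂
    · exact hL rfl _ ⟨_, _, rfl, h₁, h₂⟩
  case one_l =>
    have h₁ := ih _ (.head _) (.mk (.refl ..) hY)
    rcases hX with rfl | ⟨rfl, ⟨⟩⟩
    · exact .one (.one_l ..) h₁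
    · exact hL rfl _ h₁
  case zero_l =>
    obtain rfl := hY
    rcases hX with rfl | ⟨rfl, ⟨⟩⟩
    · exact .axm .zero_l
    · exact hL rfl _ rfl
  case cap_l =>
    have h₁ := ih _ (.head _) (.mk (.refl ..) hY)
    rcases hX with rfl | ⟨rfl, ⟨⟩⟩
    · exact .one (.cap_l ..) h₁
    · exact hL rfl _ h₁
  case cup_l =>
    rcases hY with ⟨U, V, rfl, hU, hV⟩
    have h₁ := ih _ (.head _) (.mk (fm_self ..) hU)
    have h₂ := ih _ (.tail _ (.head _)) (.mk (fm_self ..) hV)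
    rcases hX with rfl | ⟨rfl, ⟨⟩⟩
    · exact .two (.cup_l ..) h₁ h₂
    · exact hL rfl _ ⟨_, _, rfl, h₁, h₂⟩
  case neg_l =>
    have h₁ := ih _ (.head _) (.mk (.refl ..) hY)
    rcases hX with rfl | ⟨rfl, ⟨⟩⟩
    · exact .one (.neg_l ..) h₁
    · exact hL rfl _ h₁
  case circ_l =>
    have h₁ := ih _ (.head _) (.mk (.refl ..) hY)
    rcases hX with rfl | ⟨rfl, ⟨⟩⟩
    · exact .one (.circ_l ..) h₁
    · exact hL rfl _ h₁
  case box_l =>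
    rcases hY with ⟨U, rfl, hU⟩
    have h₁ := ih _ (.head _) (.mk (fm_self ..) hU)
    rcases hX with rfl | ⟨rfl, ⟨⟩⟩
    · exact .one (.box_l ..) h₁
    · exact hL rfl _ ⟨_, rfl, h₁⟩
  case top_r =>
    obtain rfl := hX
    rcases hY with rfl | ⟨hb, ⟨⟩⟩
    · exact .axm .top_r
    · exact hR (by simpa using hb) _ rfl
  case bot_r =>
    have h₁ := ih _ (.head _) (.mk hX (.refl ..))
    rcases hY with rfl | ⟨hb, ⟨⟩⟩
    · exact .one (.bot_r ..) h₁
    · exact hR (by simpa using hb) _ h₁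
  case and_r =>
    rcases hX with ⟨U, V, rfl, hU, hV⟩
    have h₁ := ih _ (.head _) (.mk hU (fm_self ..))
    have h₂ := ih _ (.tail _ (.head _)) (.mk hV (fm_self ..))
    rcases hY with rfl | ⟨hb, ⟨⟩⟩
    · exact .two (.and_r ..) h₁ h₂
    · exact hR (by simpa using hb) _ ⟨_, _, rfl, h₁, h₂⟩
  case or_r =>
    have h₁ := ih _ (.head _) (.mk hX (.refl ..))
    rcases hY with rfl | ⟨hb, ⟨⟩⟩
    · exact .one (.or_r ..) h₁
    · exact hR (by simpa using hb) _ h₁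
  case one_r =>
    obtain rfl := hX
    rcases hY with rfl | ⟨hb, ⟨⟩⟩
    · exact .axm .one_r
    · exact hR (by simpa using hb) _ rfl
  case zero_r =>
    have h₁ := ih _ (.head _) (.mk hX (.refl ..))
    rcases hY with rfl | ⟨hb, ⟨⟩⟩
    · exact .one (.zero_r ..) h₁
    · exact hR (by simpa using hb) _ h₁
  case cap_r =>
    rcases hX with ⟨U, V, rfl, hU, hV⟩
    have h₁ := ih _ (.head _) (.mk hU (fm_self ..))
    have h₂ := ih _ (.tail _ (.head _)) (.mk hV (fm_self ..))
    rcases hY with rfl | ⟨hb, ⟨⟩⟩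
    · exact .two (.cap_r ..) h₁ h₂
    · exact hR (by simpa using hb) _ ⟨_, _, rfl, h₁, h₂⟩
  case cup_r =>
    have h₁ := ih _ (.head _) (.mk hX (.refl ..))
    rcases hY with rfl | ⟨hb, ⟨⟩⟩
    · exact .one (.cup_r ..) h₁
    · exact hR (by simpa using hb) _ h₁
  case neg_r =>
    have h₁ := ih _ (.head _) (.mk hX (.refl ..))
    rcases hY with rfl | ⟨hb, ⟨⟩⟩
    · exact .one (.neg_r ..) h₁
    · exact hR (by simpa using hb) _ h₁
  case circ_r =>
    have h₁ := ih _ (.head _) (.mk hX (.refl ..))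
    rcases hY with rfl | ⟨hb, ⟨⟩⟩
    · exact .one (.circ_r ..) h₁
    · exact hR (by simpa using hb) _ h₁
  case box_r =>
    have h₁ := ih _ (.head _) (.mk hX (.refl ..))
    rcases hY with rfl | ⟨hb, ⟨⟩⟩
    · exact .one (.box_r ..) h₁
    · exact hR (by simpa using hb) _ h₁
  -- The remaining rules are structural: they contain no formulas and respect polarity.
  all_goals
    simp -failIfUnchanged only [Repl, Bool.not_not] at hX hY
    try casesm* _ ∧ _, ∃ _, _
    subst_vars
  case exch_and =>
    exact .one (.exch_and ..) (ih _ (.head _)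
      (.mk (by simp [Repl, *]) (by simp [Repl, *])))
  case exch_or =>
    exact .one (.exch_or ..) (ih _ (.head _)
      (.mk (by simp [Repl, *]) (by simp [Repl, *])))
  case weak_and =>
    exact .one (.weak_and ..) (ih _ (.head _)
      (.mk (by simp [Repl, *]) (by simp [Repl, *])))
  case weak_or =>
    exact .one (.weak_or ..) (ih _ (.head _)
      (.mk (by simp [Repl, *]) (by simp [Repl, *])))
  case contr_and =>
    exact .one (.contr_and ..) (ih _ (.head _)
      (.mk (by simp [Repl, *]) (by simp [Repl, *])))
  case contr_or =>
    exact .one (.contr_or ..) (ih _ (.head _)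
      (.mk (by simp [Repl, *]) (by simp [Repl, *])))
  case exch_cap =>
    exact .one (.exch_cap ..) (ih _ (.head _)
      (.mk (by simp [Repl, *]) (by simp [Repl, *])))
  case exch_cup =>
    exact .one (.exch_cup ..) (ih _ (.head _)
      (.mk (by simp [Repl, *]) (by simp [Repl, *])))
  case weak_cap =>
    exact .one (.weak_cap ..) (ih _ (.head _)
      (.mk (by simp [Repl, *]) (by simp [Repl, *])))
  case weak_cup =>
    exact .one (.weak_cup ..) (ih _ (.head _)
      (.mk (by simp [Repl, *]) (by simp [Repl, *])))
  case contr_cap =>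
    exact .one (.contr_cap ..) (ih _ (.head _)
      (.mk (by simp [Repl, *]) (by simp [Repl, *])))
  case contr_cup =>
    exact .one (.contr_cup ..) (ih _ (.head _)
      (.mk (by simp [Repl, *]) (by simp [Repl, *])))
  case circ =>
    exact .one (.circ ..) (ih _ (.head _)
      (.mk (by simp [Repl, *]) (by simp [Repl, *])))
  case bul =>
    exact .one (.bul ..) (ih _ (.head _)
      (.mk (by simp [Repl, *]) (by simp [Repl, *])))
  case dia_one =>
    exact .one (.dia_one ..) (ih _ (.head _)
      (.mk (by simp [Repl, *]) (by simp [Repl, *])))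
  case box_zero =>
    exact .one (.box_zero ..) (ih _ (.head _)
      (.mk (by simp [Repl, *]) (by simp [Repl, *])))
  case lqm =>
    exact .one (.lqm rfl ..) (ih _ (.head _)
      (.mk (by simp [Repl, *]) (by simp [Repl, *])))
  case uqm =>
    exact .one (.uqm rfl ..) (ih _ (.head _)
      (.mk (by simp [Repl, *]) (by simp [Repl, *])))
  case ap =>
    exact .one (.ap rfl ..) (ih _ (.head _)
      (.mk (by simp [Repl, *]) (by simp [Repl, *])))
  case ws =>
    exact .one (.ws rfl ..) (ih _ (.head _)
      (.mk (by simp [Repl, *]) (by simp [Repl, *])))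

/-! ### Cut elimination -/

/-- Cut on `A` is admissible if it is in the case where both premises introduce `A`. -/
theorem Provable.cut_of_reduction {t : Ty} {A : Fm P t}
    (hA : ∀ X Y, IntroR L A X → IntroL L A Y → Provable L (X ⊢ₛ Y)) {X Y : Str P t}
    (hX : Provable L (X ⊢ₛ .fm A)) (hY : Provable L (.fm A ⊢ₛ Y)) : Provable L (X ⊢ₛ Y) :=
  -- The outer replacement reduces to `A` introduced in the left premise, the inner one to `A`
  -- introduced in the right premise as well.
  hX.replace (A := A) (Z := Y) (b := false) (by simp)
    (fun _ X' hX' => hY.replace (A := A) (Z := X') (b := true) (fun _ Y' => hA X' Y' hX') (by simp)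
      (.mk (.inr ⟨rfl, .mk⟩) (.refl ..)))
    (.mk (.refl ..) (.inr ⟨rfl, .mk⟩))

/-- The cut rules are admissible in the cut-free calculus. -/
theorem Provable.cut {t : Ty} (A : Fm P t) {X Y : Str P t} (hX : Provable L (X ⊢ₛ .fm A))
    (hY : Provable L (.fm A ⊢ₛ Y)) : Provable L (X ⊢ₛ Y) := by
  induction A with
  | var p =>
    refine cut_of_reduction ?_ hX hY
    rintro _ _ rfl rfl
    exact .axm (.id p)
  | top | one =>
    refine cut_of_reduction ?_ hX hY
    rintro _ _ rfl h
    exact h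
  | bot | zero =>
    refine cut_of_reduction ?_ hX hY
    rintro _ _ h rfl
    exact h
  | box α ih =>
    refine cut_of_reduction ?_ hX hY
    rintro X _ h ⟨Γ, rfl, h'⟩
    exact (ih (h.down (.adj_box ..)) h').up (.adj_box ..)
  | and A B ihA ihB =>
    refine cut_of_reduction ?_ hX hY
    rintro _ Y ⟨U, V, rfl, hU, hV⟩ h
    have h₁ := (ihB hV (h.down (.res_and ..))).up (.res_and ..)
    have h₂ := Provable.one (.exch_and ..) h₁
    exact .one (.exch_and ..) ((ihA hU (h₂.down (.res_and ..))).up (.res_and ..))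
  | or A B ihA ihB =>
    refine cut_of_reduction ?_ hX hY
    rintro X _ h ⟨U, V, rfl, hU, hV⟩
    have h₁ := (ihB (h.down (.res_or ..)) hV).up (.res_or ..)
    have h₂ := Provable.one (.exch_or ..) h₁
    exact .one (.exch_or ..) ((ihA (h₂.down (.res_or ..)) hU).up (.res_or ..))
  | circ A ih =>
    refine cut_of_reduction ?_ hX hY
    intro X Y h h'
    exact .one (.bul ..) (ih (h.down (.adj_circ_r ..)) (h'.down (.adj_circ_l ..)))
  | neg α ih =>
    refine cut_of_reduction ?_ hX hY
    intro X Y h h'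
    exact (ih (h'.down (.adj_star_l ..)) (h.down (.adj_star_r ..))).up (.cont ..)
  | cap α β ihα ihβ =>
    refine cut_of_reduction ?_ hX hY
    rintro _ Y ⟨U, V, rfl, hU, hV⟩ h
    have h₁ := (ihβ hV (h.down (.res_cap ..))).up (.res_cap ..)
    have h₂ := Provable.one (.exch_cap ..) h₁
    exact .one (.exch_cap ..) ((ihα hU (h₂.down (.res_cap ..))).up (.res_cap ..))
  | cup α β ihα ihβ =>
    refine cut_of_reduction ?_ hX hY
    rintro X _ h ⟨U, V, rfl, hU, hV⟩
    have h₁ := (ihβ (h.down (.res_cup ..)) hV).up (.res_cup ..)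
    have h₂ := Provable.one (.exch_cup ..) h₁
    exact .one (.exch_cup ..) ((ihα (h₂.down (.res_cup ..)) hU).up (.res_cup ..))

theorem Deriv.provable {s : Sequent P} (d : Deriv L s) : Provable L s := by
  induction d with
  | rule r _ ih =>
    refine .rule r fun q hq => ?_
    obtain ⟨i, rfl⟩ := List.get_of_mem hq
    exact ih i
  | cut A _ _ ihd ihe => exact .cut A ihd ihe

/-! ### The subformula property -/

theorem Fm.mem_subformulas_self {t : Ty} (A : Fm P t) : ⟨t, A⟩ ∈ A.subformulas := by
  cases A <;> simp [Fm.subformulas]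

theorem Fm.subformulas_subset {t : Ty} (A : Fm P t) {B : Σ t, Fm P t} (h : B ∈ A.subformulas) :
    B.2.subformulas ⊆ A.subformulas := by
  induction A with
  | var | top | bot | one | zero =>
    obtain rfl : B = _ := h
    exact subset_rfl
  | box _ ih | circ _ ih | neg _ ih =>
    rcases h with rfl | h
    · exact subset_rfl
    · exact (ih h).trans Set.subset_union_right
  | and _ _ ih ih' | or _ _ ih ih' | cap _ _ ih ih' | cup _ _ ih ih' =>
    rcases h with rfl | h | h
    · exact subset_rfl
    · exact (ih h).trans (Set.subset_union_left.trans Set.subset_union_right)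
    · exact (ih' h).trans (Set.subset_union_right.trans Set.subset_union_right)

theorem DoubleRule.formulas_eq {s t : Sequent P} (r : DoubleRule L s t) :
    s.formulas = t.formulas := by
  cases r <;> ext <;> simp only [Sequent.formulas, Str.formulas, Set.mem_union,
    Set.mem_empty_iff_false] <;> tauto

/-- No rule other than cut has a formula in a premise that is not a subformula of a formula in the
conclusion. -/
theorem Rule.exists_mem_subformulas {ps : List (Sequent P)} {s : Sequent P} (r : Rule L ps s)
    {q : Sequent P} (hq : q ∈ ps) {A : Σ t, Fm P t} (hA : A ∈ q.formulas) :
    ∃ B ∈ s.formulas, A ∈ B.2.subformulas := by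
  have self {F : Set (Σ t, Fm P t)} (h : A ∈ F) : ∃ B ∈ F, A ∈ B.2.subformulas :=
    ⟨A, h, A.2.mem_subformulas_self⟩
  have of_eq {t : Ty} {B : Fm P t} (h : A = ⟨t, B⟩) : A ∈ B.subformulas :=
    h ▸ B.mem_subformulas_self
  cases r
  case down r =>
    obtain rfl := List.mem_singleton.1 hq
    exact self (r.formulas_eq ▸ hA)
  case up r =>
    obtain rfl := List.mem_singleton.1 hq
    exact self (r.formulas_eq ▸ hA)
  all_goals
    simp only [List.mem_cons, List.not_mem_nil, or_false] at hq
    try rcases hq with rfl | rfl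
  all_goals
    simp only [Sequent.formulas, Str.formulas, Set.mem_union, Set.mem_singleton_iff,
      Set.mem_empty_iff_false, or_and_right, exists_or, exists_eq_left, false_or, or_false,
      Fm.subformulas] at hA ⊢
    grind

theorem Deriv.CutFree.exists_mem_subformulas {s : Sequent P} {d : Deriv L s} (hd : d.CutFree)
    {q : Sequent P} (hq : q ∈ d.sequents) {A : Σ t, Fm P t} (hA : A ∈ q.formulas) :
    ∃ B ∈ s.formulas, A ∈ B.2.subformulas := by
  induction d with
  | rule r ds ih =>
    simp only [Deriv.CutFree] at hd
    simp only [Deriv.sequents, Set.mem_union, Set.mem_singleton_iff, Set.mem_iUnion] at hq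
    obtain rfl | ⟨i, hi⟩ := hq
    · exact ⟨A, hA, A.2.mem_subformulas_self⟩
    · obtain ⟨B, hB, hAB⟩ := ih i (hd i) hi
      obtain ⟨C, hC, hBC⟩ := r.exists_mem_subformulas (List.get_mem _ i) hB
      exact ⟨C, hC, C.2.subformulas_subset hBC hAB⟩
  | cut => simp [Deriv.CutFree] at hd

end SDM

theorem mainTheorem1 {P : Type*} (L : SDM.Calculus) :
    SDM.CutElimination P L ∧ SDM.SubformulaProperty P L :=
  ⟨fun _ ⟨d⟩ => d.provable.exists_cutFree,
    fun _ _ hd _ hq _ hA => hd.exists_mem_subformulas hq hA⟩
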